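/- Let $f:\mathbb{R}^2\to\mathbb{R}^2$ be a $C^\infty$ map, let $\lambda,\sigma\in\mathbb{R}$ with $0<|\lambda|<1<|\sigma|$, let $F,G:\mathbb{R}^2\to\mathbb{R}$ be $C^\infty$, and let $\mathcal{N}$ be a bounded convex neighbourhood of the origin such that for all $(x,y)\in\mathcal{N}$ $$f(x,y)=T_0(x,y)=\bigl(\lambda x(1+xyF(x,y)),\ \sigma y(1+xyG(x,y))\bigr).$$ Let $x^*,y^*>0$ be such that $(x^*,0)$, $(\lambda x^*,0)$, $(0,y^*/\sigma)$, $(0,y^*/\sigma^2)\in\mathcal{N}$ and $f^m(0,y^*)=(x^*,0)$ for some $m\ge 1$. Put $T_1=f^m$, with Taylor expansion at $(0,y^*)$ $$T_1(x,y)=\begin{bmatrix}x^*+c_1x+c_2(y-y^*)+\mathcal{O}(2)\\ d_1x+d_2(y-y^*)+d_3x^2+d_4x(y-y^*)+d_5(y-y^*)^2+\mathcal{O}(3)\end{bmatrix},$$ where $\mathcal{O}(n)$ denotes terms of order at least $n$ in $(x,y-y^*)$, and assume $c_1d_2-c_2d_1\neq 0$. For $\eta>0$ let $\mathcal{N}_\eta=\{(x,y)\in\mathcal{N}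 : |xy|<\eta\}$. An $\mathrm{SR}_k$-solution is an orbit $(x^{(k)}_j,y^{(k)}_j)=f^j(x^{(k)}_0,y^{(k)}_0)$, $j\ge 0$, of $f$ with $f^{k+m}(x^{(k)}_0,y^{(k)}_0)=(x^{(k)}_0,y^{(k)}_0)$ and $(x^{(k)}_j,y^{(k)}_j)\in\mathcal{N}_\eta$ for $j=0,\dots,k-1$. It is stable if it is Lyapunov stable: for every $\varepsilon>0$ there is $\delta>0$ such that $|q-(x^{(k)}_0,y^{(k)}_0)|<\delta$ implies $|f^n(q)-f^n(x^{(k)}_0,y^{(k)}_0)|<\varepsilon$ for all $n\ge 0$. Then there exists $\eta>0$ with the following property. Suppose that for infinitely many $k$ the map $f$ has a stable $\mathrm{SR}_k$-solution, that the points $(x^{(k)}_0,y^{(k)}_0)$ of these solutions converge to $(x^*,0)$ as $k\to\infty$, and that the points $(x^{(k)}_k,y^{(k)}_k)$ at which the excursions begin lie in some neighbourhood $V$ of $(0,y^*)$ on which $T_1$ is injective (such $V$ exist because $c_1d_2-c_2d_1\ne0$; if $f$ is injective, $V=\mathbb{R}^2$ is allowed and this last condition is void). Then $$d_2=0.$$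 If also $d_5\neq 0$, then $$|\lambda\sigma|=1\quad\text{and}\quad |d_1|=\frac{y^*}{x^*},$$ with $d_1=\frac{y^*}{x^*}$ in the case $\lambda\sigma=1$. -/

import Mathlib

open Filter Topology
open scoped ContDiff

noncomputable section

namespace HomoclinicTangency

/-- The local normal form `T₀(x, y) = (λ x (1 + x y F(x, y)), σ y (1 + x y G(x, y)))`. -/
def localMap (lam sig : ℝ) (F G : ℝ × ℝ → ℝ) (p : ℝ × ℝ) : ℝ × ℝ :=
  (lam * p.1 * (1 + p.1 * p.2 * F p), sig * p.2 * (1 + p.1 * p.2 * G p))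

/-- The set `N_η` of the points `(x, y)` of `N` with `|x y| < η`. -/
def thinNbhd (N : Set (ℝ × ℝ)) (η : ℝ) : Set (ℝ × ℝ) :=
  {p | p ∈ N ∧ |p.1 * p.2| < η}

/-- `p` is the initial point of an `SR_k`-solution of `f`: its orbit closes up after `k + m`
steps, and its first `k` points (indices `0, …, k - 1`) lie in `N_η`. -/
structure IsSRSolution (f : ℝ × ℝ → ℝ × ℝ) (N : Set (ℝ × ℝ)) (η : ℝ) (m k : ℕ)
    (p : ℝ × ℝ) : Prop where
  periodic : Function.IsPeriodicPt f (k + m) p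
  mem_thinNbhd : ∀ j < k, f^[j] p ∈ thinNbhd N η

/-- Lyapunov stability of the forward orbit of `p` under `f`. This is the weakest of the usual
meanings of a stable periodic solution (asymptotic stability includes it). -/
def IsStableOrbit (f : ℝ × ℝ → ℝ × ℝ) (p : ℝ × ℝ) : Prop :=
  ∀ ε > 0, ∃ δ > 0, ∀ q : ℝ × ℝ, dist q p < δ → ∀ n : ℕ, dist (f^[n] q) (f^[n] p) < ε

/-! Taylor coefficients at `(0, y*)` of a planar map `T`: the first component has linear part
`c₁ x + c₂ (y - y*)`; the second component has linear part `d₁ x + d₂ (y - y*)`, and the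
coefficient of `(y - y*)²` in it is `d₅`. -/

def c₁ (T : ℝ × ℝ → ℝ × ℝ) (ystar : ℝ) : ℝ := deriv (fun x : ℝ => (T (x, ystar)).1) 0

def c₂ (T : ℝ × ℝ → ℝ × ℝ) (ystar : ℝ) : ℝ := deriv (fun y : ℝ => (T (0, y)).1) ystar

def d₁ (T : ℝ × ℝ → ℝ × ℝ) (ystar : ℝ) : ℝ := deriv (fun x : ℝ => (T (x, ystar)).2) 0

def d₂ (T : ℝ × ℝ → ℝ × ℝ) (ystar : ℝ) : ℝ := deriv (fun y : ℝ => (T (0, y)).2) ystar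

def d₅ (T : ℝ × ℝ → ℝ × ℝ) (ystar : ℝ) : ℝ :=
  iteratedDeriv 2 (fun y : ℝ => (T (0, y)).2) ystar / 2

end HomoclinicTangency

end

/-! Let (x₀, y₀) be the initial point of an orbit and q = (X, Y) its k-th iterate, where the
excursion begins. During the passage |xy| = O(ρ^k) with ρ < 1, so the k relative errors of the
normal form add up to O(k ρ^k): the passage is asymptotically diag(λ^k, σ^k), and its derivative, in
coordinates scaled by the base points, tends to the identity
(`LocalControl.exists_passage_asymptotics`).

Let ψ be the y-derivative of the second component of T₁. For the derivative of the return map, y₀ ·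
trace = ψ(q) Y (1 + o(1)) + O(|X| + |y₀|), and y₀² · det = O(|X y₀|). Stability forces trace² ≤ 4 +
4|det| (`trace_sq_le_of_stable`), hence ψ(q) = O(|X| + |y₀|) (`vertical_derivative_isBigO`). Since q
→ (0, y*), the limit is d₂ = 0.

If d₅ ≠ 0, then ψ and X control Y - y*, and the closing equation reads y₀ = d₁ X + o(|X| + |y₀|), so
y₀ / X → d₁ (`tendsto_div_of_tangency`). Multiplying X ~ λ^k x₀ and Y ~ σ^k y₀ gives (λσ)^k → y*/(x*
d₁). Powers have a nonzero limit only if |λσ| = 1, and the limit then has modulus 1. -/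

namespace HomoclinicTangency

/-! ### Instability from an expanding dominating direction -/

/-- A fixed point whose derivative has a dominated splitting with an expanding dominating part
is not Lyapunov stable. -/
theorem not_stable_of_dominated_splitting {E : Type*} [NormedAddCommGroup E] [NormedSpace ℝ E]
    {g : E → E} {p : E} {L P Q : E →L[ℝ] E} {μ ν : ℝ} {w : E}
    (hg : HasFDerivAt g L p) (hp : g p = p) (hPQ : ∀ v, P v + Q v = v)
    (hP : ∀ v, P (L v) = μ • P v) (hQ : ∀ v, Q (L v) = ν • Q v)
    (hμ : 1 < |μ|) (hνμ : |ν| < |μ|) (hPw : P w ≠ 0) (hQw : Q w = 0) :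
    ¬ ∀ ε > 0, ∃ δ > 0, ∀ q, dist q p < δ → ∀ n : ℕ, dist (g^[n] q) p < ε := by
  intro hst
  -- κ is the growth rate to be enforced on the P-component inside the cone ‖Q v‖ ≤ ‖P v‖.
  obtain ⟨κ, hκ, hκμ⟩ := exists_between (max_lt hμ hνμ)
  have hκ1 : 1 < κ := lt_of_le_of_lt (le_max_left _ _) hκ
  have hκν : |ν| < κ := lt_of_le_of_lt (le_max_right _ _) hκ
  -- In the cone ‖v‖ ≤ 2‖P v‖, so a remainder of size c‖v‖ fits into the spectral gaps |μ| - κ and κ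
  -- - |ν|.
  obtain ⟨c, hc, hcP, hcQ⟩ : ∃ c > 0, 2 * c * ‖P‖ ≤ |μ| - κ ∧ 2 * c * ‖Q‖ ≤ κ - |ν| := by
    refine ⟨min ((|μ| - κ) / (2 * (‖P‖ + 1))) ((κ - |ν|) / (2 * (‖Q‖ + 1))), ?_, ?_, ?_⟩
    · have h1 : 0 < |μ| - κ := by linarith
      have h2 : 0 < κ - |ν| := by linarith
      positivity
    · have h1 : 0 < |μ| - κ := by linarith
      calc _ ≤ 2 * ((|μ| - κ) / (2 * (‖P‖ + 1))) * ‖P‖ := by gcongr; exact min_le_left _ _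
        _ = (|μ| - κ) * (‖P‖ / (‖P‖ + 1)) := by field_simp
        _ ≤ (|μ| - κ) * 1 := by
          gcongr; exact (div_le_one (by positivity)).2 (by linarith)
        _ = _ := mul_one _
    · have h1 : 0 < κ - |ν| := by linarith
      calc _ ≤ 2 * ((κ - |ν|) / (2 * (‖Q‖ + 1))) * ‖Q‖ := by gcongr; exact min_le_right _ _
        _ = (κ - |ν|) * (‖Q‖ / (‖Q‖ + 1)) := by field_simp
        _ ≤ (κ - |ν|) * 1 := by
          gcongr; exact (div_le_one (by positivity)).2 (by linarith)
        _ = _ := mul_one _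
  obtain ⟨r, hr, hlin⟩ := Metric.eventually_nhds_iff.1 (hg.isLittleO.def hc)
  obtain ⟨δ, hδ, hδr⟩ := hst r hr
  obtain ⟨t, ht, htw⟩ : ∃ t : ℝ, 0 < t ∧ ‖t • w‖ < δ := by
    refine ⟨δ / (2 * (‖w‖ + 1)), by positivity, ?_⟩
    rw [norm_smul, Real.norm_of_nonneg (by positivity), div_mul_eq_mul_div,
      div_lt_iff₀ (by positivity)]
    nlinarith [norm_nonneg w]
  have hball : ∀ n, dist (g^[n] (p + t • w)) p < r := hδr _ (by simpa using htw)
  -- The cone is forward invariant and P grows in it by the factor κ. Stability keeps the orbit in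
  -- the ball where this holds, which contradicts the growth.
  have hstep : ∀ q, dist q p < r → ‖Q (q - p)‖ ≤ ‖P (q - p)‖ →
      ‖Q (g q - p)‖ ≤ κ * ‖P (q - p)‖ ∧ κ * ‖P (q - p)‖ ≤ ‖P (g q - p)‖ := by
    intro q hq hcone
    set v := q - p with hv
    set e := g q - g p - L v with he
    have hgq : g q - p = L v + e := by rw [he, hp]; abel
    have hen : ‖e‖ ≤ 2 * c * ‖P v‖ := by
      have h1 : ‖v‖ ≤ ‖P v‖ + ‖Q v‖ := by
        conv_lhs => rw [← hPQ v]
        exact norm_add_le _ _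
      calc ‖e‖ ≤ c * ‖v‖ := hlin hq
        _ ≤ c * (2 * ‖P v‖) := by gcongr; linarith
        _ = _ := by ring
    have hPe : ‖P e‖ ≤ (|μ| - κ) * ‖P v‖ := by
      calc ‖P e‖ ≤ ‖P‖ * ‖e‖ := P.le_opNorm e
        _ ≤ ‖P‖ * (2 * c * ‖P v‖) := by gcongr
        _ = 2 * c * ‖P‖ * ‖P v‖ := by ring
        _ ≤ _ := by gcongr
    have hQe : ‖Q e‖ ≤ (κ - |ν|) * ‖P v‖ := by
      calc ‖Q e‖ ≤ ‖Q‖ * ‖e‖ := Q.le_opNorm e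
        _ ≤ ‖Q‖ * (2 * c * ‖P v‖) := by gcongr
        _ = 2 * c * ‖Q‖ * ‖P v‖ := by ring
        _ ≤ _ := by gcongr
    rw [hgq, map_add, map_add, hP, hQ]
    constructor
    · calc _ ≤ ‖ν • Q v‖ + ‖Q e‖ := norm_add_le _ _
        _ = |ν| * ‖Q v‖ + ‖Q e‖ := by rw [norm_smul, Real.norm_eq_abs]
        _ ≤ |ν| * ‖P v‖ + (κ - |ν|) * ‖P v‖ := by gcongr
        _ = _ := by ring
    · have h1 : ‖μ • P v‖ - ‖P e‖ ≤ ‖μ • P v + P e‖ := by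
        simpa using norm_sub_norm_le (μ • P v) (-P e)
      rw [norm_smul, Real.norm_eq_abs] at h1
      linarith
  have hgrow : ∀ n, ‖Q (g^[n] (p + t • w) - p)‖ ≤ ‖P (g^[n] (p + t • w) - p)‖ ∧
      κ ^ n * ‖P (t • w)‖ ≤ ‖P (g^[n] (p + t • w) - p)‖ := by
    intro n
    induction n with
    | zero => simp [hQw]
    | succ n ih =>
      obtain ⟨h1, h2⟩ := hstep _ (hball n) ih.1
      rw [Function.iterate_succ_apply']
      refine ⟨h1.trans h2, ?_⟩
      calc _ = κ * (κ ^ n * ‖P (t • w)‖) := by ring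
        _ ≤ κ * ‖P (g^[n] (p + t • w) - p)‖ := by gcongr; exact ih.2
        _ ≤ _ := h2
  have hpos : 0 < ‖P (t • w)‖ := by
    rw [map_smul]; exact norm_pos_iff.2 (smul_ne_zero ht.ne' hPw)
  obtain ⟨n, hn⟩ := pow_unbounded_of_one_lt (‖P‖ * r / ‖P (t • w)‖) hκ1
  rw [div_lt_iff₀ hpos] at hn
  have h1 := (hgrow n).2
  have h2 := P.le_opNorm (g^[n] (p + t • w) - p)
  have h3 : ‖g^[n] (p + t • w) - p‖ ≤ r := by
    rw [← dist_eq_norm]; exact (hball n).le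
  have h4 := mul_le_mul_of_nonneg_left h3 (norm_nonneg P)
  linarith

/-! ### Planar linear maps: trace, determinant and stability -/

/-- The matrix entries of a planar linear map. -/
theorem planar_apply (L : ℝ × ℝ →L[ℝ] ℝ × ℝ) (v : ℝ × ℝ) :
    L v = v.1 • L (1, 0) + v.2 • L (0, 1) := by
  rw [← map_smul, ← map_smul, ← map_add]; simp

/-- The trace of a planar linear map. -/
def planarTrace (L : ℝ × ℝ →L[ℝ] ℝ × ℝ) : ℝ := (L (1, 0)).1 + (L (0, 1)).2

/-- The determinant of a planar linear map. -/
def planarDet (L : ℝ × ℝ →L[ℝ] ℝ × ℝ) : ℝ :=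
  (L (1, 0)).1 * (L (0, 1)).2 - (L (0, 1)).1 * (L (1, 0)).2

theorem planar_cayley_hamilton (L : ℝ × ℝ →L[ℝ] ℝ × ℝ) (v : ℝ × ℝ) :
    L (L v) = planarTrace L • L v - planarDet L • v := by
  rw [planar_apply L (L v), planar_apply L v]
  ext <;> simp [planarTrace, planarDet] <;> ring

/-- At a Lyapunov stable fixed point of a planar map, the derivative has no real eigenvalue
outside the unit circle dominating the other one. -/
theorem trace_sq_le_of_stable {g : ℝ × ℝ → ℝ × ℝ} {p : ℝ × ℝ} {L : ℝ × ℝ →L[ℝ] ℝ × ℝ}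
    (hg : HasFDerivAt g L p) (hp : g p = p)
    (hst : ∀ ε > 0, ∃ δ > 0, ∀ q, dist q p < δ → ∀ n : ℕ, dist (g^[n] q) p < ε) :
    planarTrace L ^ 2 ≤ 4 + 4 * |planarDet L| := by
  by_contra! hlt
  set τ := planarTrace L with hτ
  set D := planarDet L with hD
  have hD0 := abs_nonneg D
  have hdisc : 0 < τ ^ 2 - 4 * D := by linarith [le_abs_self D]
  have hτ2 : 2 < |τ| := by
    by_contra! h
    have := pow_le_pow_left₀ (abs_nonneg τ) h 2
    rw [sq_abs] at this
    linarith
  have hτ0 : τ ≠ 0 := by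
    intro h
    rw [h, abs_zero] at hτ2
    linarith
  -- The root of the discriminant is taken with the sign of τ, so that (τ + s)/2 is the eigenvalue
  -- of larger modulus.
  obtain ⟨s, hs0, hs, hsτ⟩ : ∃ s : ℝ, s ≠ 0 ∧ s ^ 2 = τ ^ 2 - 4 * D ∧ 0 ≤ s * τ := by
    have h0 := Real.sqrt_pos.2 hdisc
    have h1 := Real.sq_sqrt hdisc.le
    rcases le_total 0 τ with h | h
    · exact ⟨_, h0.ne', h1, mul_nonneg h0.le h⟩
    · exact ⟨-√(τ ^ 2 - 4 * D), by simpa using h0.ne', by rw [neg_sq, h1], by nlinarith⟩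
  have habs : |τ + s| = |τ| + |s| := by
    rw [abs_add_eq_add_abs_iff]
    rcases le_total 0 τ with h | h
    · have h' : 0 < τ := lt_of_le_of_ne h hτ0.symm
      exact Or.inl ⟨h, nonneg_of_mul_nonneg_left hsτ h'⟩
    · have h' : τ < 0 := lt_of_le_of_ne h hτ0
      exact Or.inr ⟨h, nonpos_of_mul_nonneg_left hsτ h'⟩
  have hspos : 0 < |s| := abs_pos.2 hs0
  set μ := (τ + s) / 2 with hμ
  set ν := (τ - s) / 2 with hν
  have hsum : μ + ν = τ := by rw [hμ, hν]; ring
  have hprod : μ * ν = D := by rw [hμ, hν]; linarith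
  have hdiff : μ - ν = s := by rw [hμ, hν]; ring
  have hμabs : |μ| = (|τ| + |s|) / 2 := by rw [hμ, abs_div, habs]; norm_num
  have hνμ : |ν| < |μ| := by
    rw [← sq_lt_sq, ← sub_pos, show μ ^ 2 - ν ^ 2 = s * τ by rw [hμ, hν]; ring]
    refine lt_of_le_of_ne hsτ (mul_ne_zero hs0 hτ0).symm
  -- P and Q are the spectral projections; their properties follow from Cayley–Hamilton.
  let P : ℝ × ℝ →L[ℝ] ℝ × ℝ := s⁻¹ • (L - ν • ContinuousLinearMap.id ℝ (ℝ × ℝ))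
  let Q : ℝ × ℝ →L[ℝ] ℝ × ℝ := -s⁻¹ • (L - μ • ContinuousLinearMap.id ℝ (ℝ × ℝ))
  have hPv : ∀ v, P v = s⁻¹ • (L v - ν • v) := fun v => rfl
  have hQv : ∀ v, Q v = -s⁻¹ • (L v - μ • v) := fun v => rfl
  have hP : ∀ v, P (L v) = μ • P v := by
    intro v
    rw [hPv, hPv, planar_cayley_hamilton, ← hτ, ← hD, ← hsum, ← hprod]
    module
  have hQ : ∀ v, Q (L v) = ν • Q v := by
    intro v
    rw [hQv, hQv, planar_cayley_hamilton, ← hτ, ← hD, ← hsum, ← hprod]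
    module
  have hPQ : ∀ v, P v + Q v = v := by
    intro v
    rw [hPv, hQv]
    calc _ = (s⁻¹ * (μ - ν)) • v := by module
      _ = v := by rw [hdiff, inv_mul_cancel₀ hs0, one_smul]
  obtain ⟨w, hw⟩ : ∃ w, P w ≠ 0 := by
    by_contra! h
    have h1 : ∀ v, L v = ν • v := by
      intro v
      have := h v
      rw [hPv, smul_eq_zero, sub_eq_zero] at this
      exact this.resolve_left (inv_ne_zero hs0)
    have h2 : τ = 2 * ν := by
      rw [hτ, planarTrace, h1, h1]; simp; ring
    exact hs0 (by rw [← hdiff]; linarith)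
  have hQP : Q (P w) = 0 := by
    rw [hQv, hPv, map_smul, map_sub, map_smul, planar_cayley_hamilton, ← hτ, ← hD, ← hsum,
      ← hprod]
    module
  have hPP : P (P w) ≠ 0 := by
    have := hPQ (P w)
    rw [hQP, add_zero] at this
    rwa [this]
  exact not_stable_of_dominated_splitting hg hp hPQ hP hQ (by rw [hμabs]; linarith) hνμ hPP hQP hst

/-! ### The normal form and its uniform bounds -/

theorem fderiv_localMap {lam sig : ℝ} {F G : ℝ × ℝ → ℝ} (hF : Differentiable ℝ F)
    (hG : Differentiable ℝ G) (p v : ℝ × ℝ) :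
    fderiv ℝ (localMap lam sig F G) p v =
      (lam * v.1 * (1 + p.1 * p.2 * F p) +
          lam * p.1 * ((v.1 * p.2 + p.1 * v.2) * F p + p.1 * p.2 * fderiv ℝ F p v),
        sig * v.2 * (1 + p.1 * p.2 * G p) +
          sig * p.2 * ((v.1 * p.2 + p.1 * v.2) * G p + p.1 * p.2 * fderiv ℝ G p v)) := by
  have h1 : HasFDerivAt (fun q : ℝ × ℝ => q.1) (ContinuousLinearMap.fst ℝ ℝ ℝ) p := hasFDerivAt_fst
  have h2 : HasFDerivAt (fun q : ℝ × ℝ => q.2) (ContinuousLinearMap.snd ℝ ℝ ℝ) p := hasFDerivAt_snd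
  have h := ((h1.const_mul lam).mul (((h1.mul h2).mul (hF p).hasFDerivAt).const_add 1)).prodMk
    ((h2.const_mul sig).mul (((h1.mul h2).mul (hG p).hasFDerivAt).const_add 1))
  have h' : fderiv ℝ (localMap lam sig F G) p = _ := HasFDerivAt.fderiv h
  rw [h']
  ext <;> simp <;> ring

/-- Two smooth maps that agree on a convex set with nonempty interior have the same derivative
there, also at boundary points. -/
theorem fderiv_eq_of_eqOn_convex {f g : ℝ × ℝ → ℝ × ℝ} (hf : ContDiff ℝ ∞ f)
    (hg : ContDiff ℝ ∞ g) {N : Set (ℝ × ℝ)} (hN : Convex ℝ N) (hne : (interior N).Nonempty)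
    (hfg : ∀ p ∈ N, f p = g p) : ∀ p ∈ N, fderiv ℝ f p = fderiv ℝ g p := by
  have h1 : Set.EqOn (fderiv ℝ f) (fderiv ℝ g) (interior N) := by
    intro p hp
    refine Filter.EventuallyEq.fderiv_eq ?_
    filter_upwards [mem_interior_iff_mem_nhds.1 hp] with q hq using hfg q hq
  have h2 := h1.closure (hf.continuous_fderiv (by simp)) (hg.continuous_fderiv (by simp))
  rw [hN.closure_interior_eq_closure_of_nonempty_interior hne] at h2
  exact fun p hp => h2 (subset_closure hp)

theorem contDiff_localMap {lam sig : ℝ} {F G : ℝ × ℝ → ℝ} (hF : ContDiff ℝ ∞ F)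
    (hG : ContDiff ℝ ∞ G) : ContDiff ℝ ∞ (localMap lam sig F G) := by
  unfold localMap
  fun_prop

/-- Quantitative control of a map that is in normal form on `N`: `M` bounds the data and `ρ` is
a rate of contraction of the coordinates, forwards and backwards respectively, in `N_η`. -/
structure LocalControl (f : ℝ × ℝ → ℝ × ℝ) (lam sig : ℝ) (F G : ℝ × ℝ → ℝ) (N : Set (ℝ × ℝ))
    (M η ρ : ℝ) : Prop where
  differentiable : Differentiable ℝ f
  differentiable_F : Differentiable ℝ F
  differentiable_G : Differentiable ℝ G
  apply_eq : ∀ p ∈ N, f p = localMap lam sig F G p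
  fderiv_eq : ∀ p ∈ N, fderiv ℝ f p = fderiv ℝ (localMap lam sig F G) p
  one_le : 1 ≤ M
  norm_le : ∀ p ∈ N, ‖p‖ ≤ M
  F_le : ∀ p ∈ N, |F p| ≤ M
  G_le : ∀ p ∈ N, |G p| ≤ M
  fderiv_F_le : ∀ p ∈ N, ‖fderiv ℝ F p‖ ≤ M
  fderiv_G_le : ∀ p ∈ N, ‖fderiv ℝ G p‖ ≤ M
  eta_pos : 0 < η
  eta_le : η * M ≤ 1 / 2
  rho_pos : 0 < ρ
  rho_lt_one : ρ < 1
  lam_ne_zero : lam ≠ 0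
  lam_le : |lam| * (1 + η * M) ≤ ρ
  le_sig : 1 ≤ ρ * (|sig| * (1 - η * M))

/-- Boundedness of N gives M by compactness of its closure. The conditions on η are strict at η = 0
once max(|λ|, 1/|σ|) < ρ < 1, so they persist for small η. -/
theorem exists_localControl {f : ℝ × ℝ → ℝ × ℝ} (hf : ContDiff ℝ ∞ f)
    {lam sig : ℝ} (hlam0 : 0 < |lam|) (hlam1 : |lam| < 1) (hsig : 1 < |sig|)
    {F G : ℝ × ℝ → ℝ} (hF : ContDiff ℝ ∞ F) (hG : ContDiff ℝ ∞ G)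
    {N : Set (ℝ × ℝ)} (hN_nhds : N ∈ 𝓝 ((0, 0) : ℝ × ℝ))
    (hN_bdd : Bornology.IsBounded N) (hN_conv : Convex ℝ N)
    (hfN : ∀ p ∈ N, f p = localMap lam sig F G p) :
    ∃ M η ρ, LocalControl f lam sig F G N M η ρ := by
  have hK := hN_bdd.isCompact_closure
  have bound : ∀ {E : Type} [NormedAddCommGroup E] (g : ℝ × ℝ → E), Continuous g →
      ∃ C, ∀ p ∈ N, ‖g p‖ ≤ C := by
    intro E _ g hg
    obtain ⟨C, hC⟩ := hK.exists_bound_of_continuousOn hg.continuousOn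
    exact ⟨C, fun p hp => hC p (subset_closure hp)⟩
  obtain ⟨C1, h1⟩ := bound (fun p => p) continuous_id
  obtain ⟨C2, h2⟩ := bound F hF.continuous
  obtain ⟨C3, h3⟩ := bound G hG.continuous
  obtain ⟨C4, h4⟩ := bound _ (hF.continuous_fderiv (by simp))
  obtain ⟨C5, h5⟩ := bound _ (hG.continuous_fderiv (by simp))
  obtain ⟨M, hM1, hM⟩ : ∃ M : ℝ, 1 ≤ M ∧ C1 ≤ M ∧ C2 ≤ M ∧ C3 ≤ M ∧ C4 ≤ M ∧ C5 ≤ M :=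
    ⟨1 + |C1| + |C2| + |C3| + |C4| + |C5|, by
      have := abs_nonneg C1; have := abs_nonneg C2; have := abs_nonneg C3
      have := abs_nonneg C4; have := abs_nonneg C5
      have := le_abs_self C1; have := le_abs_self C2; have := le_abs_self C3
      have := le_abs_self C4; have := le_abs_self C5
      refine ⟨?_, ?_, ?_, ?_, ?_, ?_⟩ <;> linarith⟩
  have hM0 : 0 < M := by linarith
  obtain ⟨ρ, hρ, hρ1⟩ := exists_between (max_lt hlam1 (inv_lt_one_of_one_lt₀ hsig))
  have hρl : |lam| < ρ := (le_max_left _ _).trans_lt hρ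
  have hρs : |sig|⁻¹ < ρ := (le_max_right _ _).trans_lt hρ
  have hρs' : 1 < ρ * |sig| := (inv_lt_iff_one_lt_mul₀ (by linarith)).1 hρs
  have hlim1 : Tendsto (fun η : ℝ => |lam| * (1 + η * M)) (𝓝 0) (𝓝 |lam|) :=
    Continuous.tendsto' (by fun_prop) _ _ (by simp)
  have hlim2 : Tendsto (fun η : ℝ => ρ * (|sig| * (1 - η * M))) (𝓝 0) (𝓝 (ρ * |sig|)) :=
    Continuous.tendsto' (by fun_prop) _ _ (by simp)
  have hlim3 : Tendsto (fun η : ℝ => η * M) (𝓝 0) (𝓝 0) :=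
    Continuous.tendsto' (by fun_prop) _ _ (by simp)
  have hev : ∀ᶠ η in 𝓝[>] (0 : ℝ), 0 < η ∧ η * M ≤ 1 / 2 ∧ |lam| * (1 + η * M) ≤ ρ ∧
      1 ≤ ρ * (|sig| * (1 - η * M)) := by
    filter_upwards [self_mem_nhdsWithin,
      (hlim1.eventually_le_const hρl).filter_mono nhdsWithin_le_nhds,
      (hlim2.eventually_const_le hρs').filter_mono nhdsWithin_le_nhds,
      (hlim3.eventually_le_const (show (0 : ℝ) < 1 / 2 by norm_num)).filter_mono
        nhdsWithin_le_nhds] with η ha hb hc hd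
    exact ⟨ha, hd, hb, hc⟩
  obtain ⟨η, hη0, hη1, hη2, hη3⟩ := hev.exists
  exact ⟨M, η, ρ,
    { differentiable := hf.differentiable (by simp)
      differentiable_F := hF.differentiable (by simp)
      differentiable_G := hG.differentiable (by simp)
      apply_eq := hfN
      fderiv_eq := fderiv_eq_of_eqOn_convex hf (contDiff_localMap hF hG) hN_conv
        ⟨_, mem_interior_iff_mem_nhds.2 hN_nhds⟩ hfN
      one_le := hM1
      norm_le := fun p hp => (h1 p hp).trans hM.1
      F_le := fun p hp => (h2 p hp).trans hM.2.1
      G_le := fun p hp => (h3 p hp).trans hM.2.2.1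
      fderiv_F_le := fun p hp => (h4 p hp).trans hM.2.2.2.1
      fderiv_G_le := fun p hp => (h5 p hp).trans hM.2.2.2.2
      eta_pos := hη0
      eta_le := hη1
      rho_pos := hlam0.trans hρl
      rho_lt_one := hρ1
      lam_ne_zero := abs_pos.1 hlam0
      lam_le := hη2
      le_sig := hη3 }⟩

/-- One coordinate of the variational equation, in coordinates scaled by the base point. -/
theorem scaled_variation_bound {c z t H h M ξ ζ W : ℝ} (hM : 1 ≤ M) (hH : |H| ≤ M)
    (htM : |t| * M ≤ 1 / 2) (hξ : |ξ| ≤ W) (hζ : |ζ| ≤ W) (hh : |h| ≤ M * (M * W)) :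
    ∃ ξ', c * (z * ξ) * (1 + t * H) + c * z * ((t * ξ + t * ζ) * H + t * h) =
      c * z * (1 + t * H) * ξ' ∧ |ξ' - ξ| ≤ 6 * M ^ 2 * |t| * W := by
  have hW : 0 ≤ W := (abs_nonneg _).trans hξ
  have htH : |t * H| ≤ 1 / 2 := by
    rw [abs_mul]
    exact (mul_le_mul_of_nonneg_left hH (abs_nonneg t)).trans htM
  have hden : 1 / 2 ≤ 1 + t * H := by linarith [neg_abs_le (t * H)]
  have hden0 : 0 < 1 + t * H := by linarith
  -- The witness solves the identity for ξ'. The constant 6 is 3 from the numerator bound times 2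
  -- from 1 + tH ≥ 1/2.
  refine ⟨ξ + t * ((ξ + ζ) * H + h) / (1 + t * H), by field_simp, ?_⟩
  rw [add_sub_cancel_left, abs_div, abs_of_pos hden0, div_le_iff₀ hden0, abs_mul]
  have h1 : |(ξ + ζ) * H + h| ≤ 3 * M ^ 2 * W := by
    calc _ ≤ |(ξ + ζ) * H| + |h| := abs_add_le _ _
      _ = |ξ + ζ| * |H| + |h| := by rw [abs_mul]
      _ ≤ (W + W) * M + M * (M * W) := by
        gcongr
        exact (abs_add_le _ _).trans (add_le_add hξ hζ)
      _ ≤ _ := by nlinarith [mul_nonneg (mul_nonneg hW (by linarith : 0 ≤ M)) (sub_nonneg.2 hM)]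
  calc |t| * |(ξ + ζ) * H + h| ≤ |t| * (3 * M ^ 2 * W) := by gcongr
    _ = 6 * M ^ 2 * |t| * W * (1 / 2) := by ring
    _ ≤ _ := by gcongr

/-! ### The passage near the saddle -/

section LocalControl

variable {f : ℝ × ℝ → ℝ × ℝ} {lam sig : ℝ} {F G : ℝ × ℝ → ℝ} {N : Set (ℝ × ℝ)} {M η ρ : ℝ}

theorem LocalControl.abs_mul_le (h : LocalControl f lam sig F G N M η ρ) {p : ℝ × ℝ}
    (hp : p ∈ thinNbhd N η) : |p.1 * p.2| * M ≤ η * M :=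
  mul_le_mul_of_nonneg_right hp.2.le (by linarith [h.one_le])

/-- Scaling by the base point and its image absorbs λ and σ, and every remaining term carries a
factor xy, off-diagonal ones included. -/
theorem LocalControl.scaled_fderiv (h : LocalControl f lam sig F G N M η ρ) {p : ℝ × ℝ}
    (hp : p ∈ thinNbhd N η) (w : ℝ × ℝ) :
    ∃ w' : ℝ × ℝ, fderiv ℝ f p (p.1 * w.1, p.2 * w.2) = ((f p).1 * w'.1, (f p).2 * w'.2) ∧
      ‖w' - w‖ ≤ 6 * M ^ 2 * |p.1 * p.2| * ‖w‖ := by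
  have hpN := hp.1
  have htM := (h.abs_mul_le hp).trans h.eta_le
  have hM := h.one_le
  have hv : ‖((p.1 * w.1, p.2 * w.2) : ℝ × ℝ)‖ ≤ M * ‖w‖ := by
    refine norm_prod_le_iff.2 ⟨?_, ?_⟩
    · rw [norm_mul]
      exact mul_le_mul ((norm_fst_le p).trans (h.norm_le p hpN)) (norm_fst_le w)
        (norm_nonneg _) (by linarith)
    · rw [norm_mul]
      exact mul_le_mul ((norm_snd_le p).trans (h.norm_le p hpN)) (norm_snd_le w)
        (norm_nonneg _) (by linarith)
  have hd : ∀ T : ℝ × ℝ →L[ℝ] ℝ, ‖T‖ ≤ M → |T (p.1 * w.1, p.2 * w.2)| ≤ M * (M * ‖w‖) := by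
    intro T hT
    exact (T.le_opNorm _).trans (mul_le_mul hT hv (norm_nonneg _) (by linarith))
  obtain ⟨ξ', h1, h1'⟩ := scaled_variation_bound (c := lam) (z := p.1) hM (h.F_le p hpN) htM
    (norm_fst_le w) (norm_snd_le w) (hd _ (h.fderiv_F_le p hpN))
  obtain ⟨ζ', h2, h2'⟩ := scaled_variation_bound (c := sig) (z := p.2) hM (h.G_le p hpN) htM
    (norm_snd_le w) (norm_fst_le w) (hd _ (h.fderiv_G_le p hpN))
  refine ⟨(ξ', ζ'), ?_, norm_prod_le_iff.2 ⟨h1', h2'⟩⟩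
  rw [h.fderiv_eq p hpN, h.apply_eq p hpN,
    fderiv_localMap h.differentiable_F h.differentiable_G]
  simp only [localMap]
  rw [← h1, ← h2]
  refine Prod.ext ?_ ?_ <;> dsimp only <;> ring

theorem LocalControl.fst_apply (h : LocalControl f lam sig F G N M η ρ) {p : ℝ × ℝ}
    (hp : p ∈ thinNbhd N η) : ∃ s, (f p).1 = lam * p.1 * (1 + s) ∧ |s| ≤ M * |p.1 * p.2| :=
  ⟨p.1 * p.2 * F p, by rw [h.apply_eq p hp.1]; rfl, by
    rw [abs_mul, mul_comm]; gcongr; exact h.F_le p hp.1⟩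

theorem LocalControl.snd_apply (h : LocalControl f lam sig F G N M η ρ) {p : ℝ × ℝ}
    (hp : p ∈ thinNbhd N η) : ∃ s, (f p).2 = sig * p.2 * (1 + s) ∧ |s| ≤ M * |p.1 * p.2| :=
  ⟨p.1 * p.2 * G p, by rw [h.apply_eq p hp.1]; rfl, by
    rw [abs_mul, mul_comm]; gcongr; exact h.G_le p hp.1⟩

theorem LocalControl.abs_fst_le (h : LocalControl f lam sig F G N M η ρ) {p : ℝ × ℝ}
    (hp : p ∈ thinNbhd N η) : |(f p).1| ≤ ρ * |p.1| := by
  obtain ⟨s, hs, hs'⟩ := h.fst_apply hp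
  have h1 := h.abs_mul_le hp
  have h2 : |1 + s| ≤ 1 + η * M := by
    calc _ ≤ |1| + |s| := abs_add_le _ _
      _ ≤ _ := by rw [abs_one]; linarith
  rw [hs, abs_mul, abs_mul]
  calc |lam| * |p.1| * |1 + s| ≤ |lam| * |p.1| * (1 + η * M) := by gcongr
    _ = |lam| * (1 + η * M) * |p.1| := by ring
    _ ≤ _ := by gcongr; exact h.lam_le

theorem LocalControl.abs_snd_le (h : LocalControl f lam sig F G N M η ρ) {p : ℝ × ℝ}
    (hp : p ∈ thinNbhd N η) : |p.2| ≤ ρ * |(f p).2| := by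
  obtain ⟨s, hs, hs'⟩ := h.snd_apply hp
  have h1 := h.abs_mul_le hp
  have h2 : 1 - η * M ≤ |1 + s| := by linarith [le_abs_self (1 + s), neg_abs_le s]
  have h3 := h.rho_pos
  rw [hs, abs_mul, abs_mul]
  calc |p.2| ≤ (ρ * (|sig| * (1 - η * M))) * |p.2| := le_mul_of_one_le_left (abs_nonneg _) h.le_sig
    _ = ρ * (|sig| * |p.2| * (1 - η * M)) := by ring
    _ ≤ _ := by gcongr

/-- The first coordinate contracts forwards from p and the second backwards from the end point. The
factors ρ^j and ρ^(k - j) combine to a bound independent of j. -/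
theorem LocalControl.abs_mul_iterate_le (h : LocalControl f lam sig F G N M η ρ) {p : ℝ × ℝ}
    {k : ℕ} (hp : ∀ j < k, f^[j] p ∈ thinNbhd N η) {j : ℕ} (hj : j ≤ k) :
    |(f^[j] p).1 * (f^[j] p).2| ≤ ρ ^ k * (|p.1| * |(f^[k] p).2|) := by
  have hρ := h.rho_pos
  have hx : ∀ j ≤ k, |(f^[j] p).1| ≤ ρ ^ j * |p.1| := by
    intro j
    induction j with
    | zero => simp
    | succ j ih =>
      intro hj
      rw [Function.iterate_succ_apply']
      calc _ ≤ ρ * |(f^[j] p).1| := h.abs_fst_le (hp j hj)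
        _ ≤ ρ * (ρ ^ j * |p.1|) := by gcongr; exact ih (by omega)
        _ = _ := by ring
  have hy : ∀ j ≤ k, |(f^[k - j] p).2| ≤ ρ ^ j * |(f^[k] p).2| := by
    intro j
    induction j with
    | zero => simp
    | succ j ih =>
      intro hj
      have h1 := h.abs_snd_le (hp (k - (j + 1)) (by omega))
      rw [← Function.iterate_succ_apply' f, show (k - (j + 1)).succ = k - j by omega] at h1
      calc _ ≤ ρ * |(f^[k - j] p).2| := h1
        _ ≤ ρ * (ρ ^ j * |(f^[k] p).2|) := by gcongr; exact ih (by omega)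
        _ = _ := by ring
  have h2 := hy (k - j) (by omega)
  rw [show k - (k - j) = j by omega] at h2
  rw [abs_mul]
  calc _ ≤ (ρ ^ j * |p.1|) * (ρ ^ (k - j) * |(f^[k] p).2|) :=
        mul_le_mul (hx j hj) h2 (abs_nonneg _) (by positivity)
    _ = ρ ^ (j + (k - j)) * (|p.1| * |(f^[k] p).2|) := by rw [pow_add]; ring
    _ = _ := by rw [show j + (k - j) = k by omega]

/-- Induction step for products of factors within e of 1. -/
theorem abs_mul_one_add_sub_one_le {a s A e : ℝ} (ha : |a - 1| ≤ A - 1) (hs : |s| ≤ e) :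
    |a * (1 + s) - 1| ≤ A * (1 + e) - 1 := by
  have h1 : |a| ≤ A := by
    calc |a| = |(a - 1) + 1| := by ring_nf
      _ ≤ |a - 1| + |1| := abs_add_le _ _
      _ ≤ A := by rw [abs_one]; linarith
  calc |a * (1 + s) - 1| = |(a - 1) + a * s| := by ring_nf
    _ ≤ |a - 1| + |a| * |s| := by rw [← abs_mul]; exact abs_add_le _ _
    _ ≤ (A - 1) + A * e := by gcongr; exact (abs_nonneg a).trans h1
    _ = _ := by ring

theorem LocalControl.fst_iterate (h : LocalControl f lam sig F G N M η ρ) {p : ℝ × ℝ} {k : ℕ}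
    {e : ℝ} (hp : ∀ j < k, f^[j] p ∈ thinNbhd N η)
    (he : ∀ j < k, M * |(f^[j] p).1 * (f^[j] p).2| ≤ e) :
    ∃ a, (f^[k] p).1 = lam ^ k * p.1 * a ∧ |a - 1| ≤ (1 + e) ^ k - 1 := by
  induction k with
  | zero => exact ⟨1, by simp⟩
  | succ k ih =>
    obtain ⟨a, ha, ha'⟩ := ih (fun j hj => hp j (by omega)) (fun j hj => he j (by omega))
    obtain ⟨s, hs, hs'⟩ := h.fst_apply (hp k (by omega))
    refine ⟨a * (1 + s), ?_, ?_⟩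
    · rw [Function.iterate_succ_apply', hs, ha]; ring
    · rw [pow_succ]
      exact abs_mul_one_add_sub_one_le ha' (hs'.trans (he k (by omega)))

theorem LocalControl.snd_iterate (h : LocalControl f lam sig F G N M η ρ) {p : ℝ × ℝ} {k : ℕ}
    {e : ℝ} (hp : ∀ j < k, f^[j] p ∈ thinNbhd N η)
    (he : ∀ j < k, M * |(f^[j] p).1 * (f^[j] p).2| ≤ e) :
    ∃ a, (f^[k] p).2 = sig ^ k * p.2 * a ∧ |a - 1| ≤ (1 + e) ^ k - 1 := by
  induction k with
  | zero => exact ⟨1, by simp⟩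
  | succ k ih =>
    obtain ⟨a, ha, ha'⟩ := ih (fun j hj => hp j (by omega)) (fun j hj => he j (by omega))
    obtain ⟨s, hs, hs'⟩ := h.snd_apply (hp k (by omega))
    refine ⟨a * (1 + s), ?_, ?_⟩
    · rw [Function.iterate_succ_apply', hs, ha]; ring
    · rw [pow_succ]
      exact abs_mul_one_add_sub_one_le ha' (hs'.trans (he k (by omega)))

theorem LocalControl.fderiv_iterate (h : LocalControl f lam sig F G N M η ρ) {p : ℝ × ℝ} {k : ℕ}
    {e : ℝ} (hp : ∀ j < k, f^[j] p ∈ thinNbhd N η)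
    (he : ∀ j < k, 6 * M ^ 2 * |(f^[j] p).1 * (f^[j] p).2| ≤ e) (w : ℝ × ℝ) :
    ∃ w' : ℝ × ℝ, fderiv ℝ f^[k] p (p.1 * w.1, p.2 * w.2) =
      ((f^[k] p).1 * w'.1, (f^[k] p).2 * w'.2) ∧ ‖w' - w‖ ≤ ((1 + e) ^ k - 1) * ‖w‖ := by
  induction k with
  | zero => exact ⟨w, by simp⟩
  | succ k ih =>
    obtain ⟨w₁, h1, h1'⟩ := ih (fun j hj => hp j (by omega)) (fun j hj => he j (by omega))
    obtain ⟨w₂, h2, h2'⟩ := h.scaled_fderiv (hp k (by omega)) w₁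
    have he' := he k (by omega)
    refine ⟨w₂, ?_, ?_⟩
    · rw [Function.iterate_succ', fderiv_comp _ (h.differentiable _)
        (h.differentiable.iterate k _), ContinuousLinearMap.comp_apply, h1, h2]
      rfl
    · have h3 : ‖w₁‖ ≤ (1 + e) ^ k * ‖w‖ := by
        calc ‖w₁‖ = ‖(w₁ - w) + w‖ := by rw [sub_add_cancel]
          _ ≤ ‖w₁ - w‖ + ‖w‖ := norm_add_le _ _
          _ ≤ _ := by linarith
      have he0 : 0 ≤ e := le_trans (by positivity) he'
      calc ‖w₂ - w‖ = ‖(w₂ - w₁) + (w₁ - w)‖ := by rw [sub_add_sub_cancel]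
        _ ≤ ‖w₂ - w₁‖ + ‖w₁ - w‖ := norm_add_le _ _
        _ ≤ e * ((1 + e) ^ k * ‖w‖) + ((1 + e) ^ k - 1) * ‖w‖ := by
          gcongr
          exact h2'.trans (by gcongr)
        _ = _ := by ring

/-- The passage near the saddle: coordinates of the end point and derivative of the `k`-th
iterate, up to a relative error. -/
theorem LocalControl.passage (h : LocalControl f lam sig F G N M η ρ) {p : ℝ × ℝ} {k : ℕ}
    {e : ℝ} (hp : ∀ j < k, f^[j] p ∈ thinNbhd N η)
    (he : 6 * M ^ 2 * (ρ ^ k * (|p.1| * |(f^[k] p).2|)) ≤ e) :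
    ∃ a b α β γ δ : ℝ,
      (f^[k] p).1 = lam ^ k * p.1 * a ∧ (f^[k] p).2 = sig ^ k * p.2 * b ∧
      fderiv ℝ f^[k] p (p.1, 0) = ((f^[k] p).1 * α, (f^[k] p).2 * γ) ∧
      fderiv ℝ f^[k] p (0, p.2) = ((f^[k] p).1 * β, (f^[k] p).2 * δ) ∧
      |a - 1| ≤ (1 + e) ^ k - 1 ∧ |b - 1| ≤ (1 + e) ^ k - 1 ∧
      |α - 1| ≤ (1 + e) ^ k - 1 ∧ |β| ≤ (1 + e) ^ k - 1 ∧
      |γ| ≤ (1 + e) ^ k - 1 ∧ |δ - 1| ≤ (1 + e) ^ k - 1 := by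
  have hM := h.one_le
  have he1 : ∀ j < k, 6 * M ^ 2 * |(f^[j] p).1 * (f^[j] p).2| ≤ e := fun j hj =>
    (mul_le_mul_of_nonneg_left (h.abs_mul_iterate_le hp hj.le) (by positivity)).trans he
  have he2 : ∀ j < k, M * |(f^[j] p).1 * (f^[j] p).2| ≤ e := fun j hj =>
    le_trans (by gcongr; nlinarith) (he1 j hj)
  obtain ⟨a, ha, ha'⟩ := h.fst_iterate hp he2
  obtain ⟨b, hb, hb'⟩ := h.snd_iterate hp he2
  obtain ⟨u, hu, hu'⟩ := h.fderiv_iterate hp he1 (1, 0)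
  obtain ⟨v, hv, hv'⟩ := h.fderiv_iterate hp he1 (0, 1)
  simp only [mul_one, mul_zero, Prod.norm_mk, norm_one, norm_zero, zero_le_one, sup_of_le_left,
    sup_of_le_right] at hu hu' hv hv'
  have hu1 := (norm_fst_le _).trans hu'
  have hu2 := (norm_snd_le _).trans hu'
  have hv1 := (norm_fst_le _).trans hv'
  have hv2 := (norm_snd_le _).trans hv'
  simp only [Prod.fst_sub, Prod.snd_sub, sub_zero, Real.norm_eq_abs] at hu1 hu2 hv1 hv2
  exact ⟨a, b, u.1, v.1, u.2, v.2, ha, hb, hu, hv, ha', hb', hu1, hv1, hu2, hv2⟩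

end LocalControl

/-! ### The excursion: determinant and Taylor coefficients -/

theorem planarDet_comp (A B : ℝ × ℝ →L[ℝ] ℝ × ℝ) :
    planarDet (A.comp B) = planarDet A * planarDet B := by
  simp only [planarDet, ContinuousLinearMap.comp_apply]
  rw [planar_apply A (B (1, 0)), planar_apply A (B (0, 1))]
  simp
  ring

theorem surjective_of_planarDet_ne_zero {A : ℝ × ℝ →L[ℝ] ℝ × ℝ} (hA : planarDet A ≠ 0) :
    Function.Surjective A := by
  intro z
  refine ⟨(((A (0, 1)).2 * z.1 - (A (0, 1)).1 * z.2) / planarDet A,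
    ((A (1, 0)).1 * z.2 - (A (1, 0)).2 * z.1) / planarDet A), ?_⟩
  rw [planar_apply A]
  ext <;> simp <;> field_simp <;> simp only [planarDet] <;> ring

section Coefficients

variable {T : ℝ × ℝ → ℝ × ℝ}

theorem hasDerivAt_comp_horizontal (hT : Differentiable ℝ T) (x y : ℝ) :
    HasDerivAt (fun x => T (x, y)) (fderiv ℝ T (x, y) (1, 0)) x :=
  (hT (x, y)).hasFDerivAt.comp_hasDerivAt x ((hasDerivAt_id x).prodMk (hasDerivAt_const x y))

theorem hasDerivAt_comp_vertical {E : Type*} [NormedAddCommGroup E] [NormedSpace ℝ E]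
    {T : ℝ × ℝ → E} (hT : Differentiable ℝ T) (x y : ℝ) :
    HasDerivAt (fun y => T (x, y)) (fderiv ℝ T (x, y) (0, 1)) y :=
  (hT (x, y)).hasFDerivAt.comp_hasDerivAt y ((hasDerivAt_const y x).prodMk (hasDerivAt_id y))

theorem c₁_eq (hT : Differentiable ℝ T) (y : ℝ) : c₁ T y = (fderiv ℝ T (0, y) (1, 0)).1 :=
  ((ContinuousLinearMap.fst ℝ ℝ ℝ).hasFDerivAt.comp_hasDerivAt _ (hasDerivAt_comp_horizontal hT 0 y)).deriv

theorem d₁_eq (hT : Differentiable ℝ T) (y : ℝ) : d₁ T y = (fderiv ℝ T (0, y) (1, 0)).2 :=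
  ((ContinuousLinearMap.snd ℝ ℝ ℝ).hasFDerivAt.comp_hasDerivAt _ (hasDerivAt_comp_horizontal hT 0 y)).deriv

theorem c₂_eq (hT : Differentiable ℝ T) (y : ℝ) : c₂ T y = (fderiv ℝ T (0, y) (0, 1)).1 :=
  ((ContinuousLinearMap.fst ℝ ℝ ℝ).hasFDerivAt.comp_hasDerivAt _ (hasDerivAt_comp_vertical hT 0 y)).deriv

theorem d₂_eq (hT : Differentiable ℝ T) (y : ℝ) : d₂ T y = (fderiv ℝ T (0, y) (0, 1)).2 :=
  ((ContinuousLinearMap.snd ℝ ℝ ℝ).hasFDerivAt.comp_hasDerivAt _ (hasDerivAt_comp_vertical hT 0 y)).deriv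

/-- Reads d₅ ≠ 0 as nonvanishing of the vertical derivative of ψ. -/
theorem d₅_eq (hT : Differentiable ℝ T)
    (hψ : Differentiable ℝ fun q => (fderiv ℝ T q (0, 1)).2) (y : ℝ) :
    2 * d₅ T y = fderiv ℝ (fun q => (fderiv ℝ T q (0, 1)).2) (0, y) (0, 1) := by
  have h : deriv (fun y : ℝ => (T (0, y)).2) = fun y => (fderiv ℝ T (0, y) (0, 1)).2 :=
    funext fun y => d₂_eq hT y
  rw [d₅, iteratedDeriv_succ, iteratedDeriv_one, h, (hasDerivAt_comp_vertical hψ 0 y).deriv]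
  ring

end Coefficients

theorem IsSRSolution.map_iterate {f : ℝ × ℝ → ℝ × ℝ} {N : Set (ℝ × ℝ)} {η : ℝ} {m k : ℕ}
    {p : ℝ × ℝ} (h : IsSRSolution f N η m k p) : f^[m] (f^[k] p) = p := by
  rw [← Function.iterate_add_apply, Nat.add_comm]
  exact h.periodic

/-- The points at which the excursions begin converge to the homoclinic point, by the inverse
function theorem and the injectivity of the return map. -/
theorem tendsto_of_injOn {α : Type*} {l : Filter α} {T : ℝ × ℝ → ℝ × ℝ} {b : ℝ × ℝ}
    {V : Set (ℝ × ℝ)} {q : α → ℝ × ℝ} (hT : ContDiff ℝ ∞ T) (hdet : planarDet (fderiv ℝ T b) ≠ 0)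
    (hV : V ∈ 𝓝 b) (hinj : Set.InjOn T V) (hq : ∀ᶠ k in l, q k ∈ V)
    (hTq : Tendsto (fun k => T (q k)) l (𝓝 (T b))) : Tendsto q l (𝓝 b) := by
  have hs : HasStrictFDerivAt T (fderiv ℝ T b) b := hT.contDiffAt.hasStrictFDerivAt (by simp)
  have hmap := hs.map_nhds_eq_of_surj
    (LinearMap.range_eq_top.2 (surjective_of_planarDet_ne_zero hdet))
  intro U hU
  -- T is open at b, so T (q k) is also attained in U ∩ V; injectivity on V identifies the two
  -- preimages.
  have himg : T '' (U ∩ V) ∈ 𝓝 (T b) := by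
    rw [← hmap]; exact image_mem_map (inter_mem hU hV)
  refine mem_map.2 ?_
  filter_upwards [hTq.eventually_mem himg, hq] with k hk hkV
  obtain ⟨z, ⟨hzU, hzV⟩, hz⟩ := hk
  rw [Set.mem_preimage, ← hinj hzV hkV hz]
  exact hzU

/-! ### Asymptotics along the family of stable orbits -/

/-- The stability condition bounds the vertical derivative of the excursion in terms of the
distance from the invariant axes. -/
theorem vertical_derivative_isBigO {l : Filter ℕ} {A B C ψ α β γ δ X Y x₀ y₀ τ D : ℕ → ℝ}
    (hA : A =O[l] (1 : ℕ → ℝ)) (hB : B =O[l] (1 : ℕ → ℝ)) (hC : C =O[l] (1 : ℕ → ℝ))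
    (hψ : ψ =O[l] (1 : ℕ → ℝ)) (hα : α =O[l] (1 : ℕ → ℝ)) (hβ : β =O[l] (1 : ℕ → ℝ))
    (hγ : γ =O[l] (1 : ℕ → ℝ)) (hδ : δ =O[l] (1 : ℕ → ℝ)) (hY : Y =O[l] (1 : ℕ → ℝ))
    (hX : X =O[l] (1 : ℕ → ℝ)) (hx : (fun k => (x₀ k)⁻¹) =O[l] (1 : ℕ → ℝ))
    (hYδ : (fun k => (Y k * δ k)⁻¹) =O[l] (1 : ℕ → ℝ))
    (hne : ∀ᶠ k in l, y₀ k ≠ 0 ∧ Y k * δ k ≠ 0)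
    (hτ : ∀ᶠ k in l, τ k = A k * (X k * α k / x₀ k) + B k * (Y k * γ k / x₀ k) +
      (C k * (X k * β k / y₀ k) + ψ k * (Y k * δ k / y₀ k)))
    (hD : ∀ᶠ k in l, D k = (A k * ψ k - B k * C k) *
      ((X k * α k / x₀ k) * (Y k * δ k / y₀ k) - (X k * β k / y₀ k) * (Y k * γ k / x₀ k)))
    (hτD : ∀ᶠ k in l, τ k ^ 2 ≤ 4 + 4 * |D k|) :
    ψ =O[l] fun k => |X k| + |y₀ k| := by
  -- The excursion has derivative matrix (A, B; C, ψ); the passage leads from (x₀, y₀) to (X, Y).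
  set S : ℕ → ℝ := fun k => |X k| + |y₀ k| with hS
  have hS0 : ∀ k, 0 ≤ S k := fun k => by positivity
  have hXS : X =O[l] S := Asymptotics.IsBigO.of_bound 1 (Eventually.of_forall fun k => by
    rw [Real.norm_eq_abs, Real.norm_of_nonneg (hS0 k), one_mul]
    exact le_add_of_nonneg_right (abs_nonneg _))
  have hyS : y₀ =O[l] S := Asymptotics.IsBigO.of_bound 1 (Eventually.of_forall fun k => by
    rw [Real.norm_eq_abs, Real.norm_of_nonneg (hS0 k), one_mul]
    exact le_add_of_nonneg_left (abs_nonneg _))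
  have mulO : ∀ {u v w : ℕ → ℝ}, u =O[l] (1 : ℕ → ℝ) → v =O[l] w → (u * v) =O[l] w := by
    intro u v w hu hv
    have h := hu.mul hv
    simp only [Pi.one_apply, one_mul] at h
    exact h
  have hyD : (fun k => y₀ k ^ 2 * D k) =O[l] fun k => S k ^ 2 := by
    have h1 : ((A * ψ - B * C) * ((α * δ - β * γ) * (Y * (fun k => (x₀ k)⁻¹)))) =O[l]
        (1 : ℕ → ℝ) :=
      mulO ((mulO hA hψ).sub (mulO hB hC)) (mulO ((mulO hα hδ).sub (mulO hβ hγ)) (mulO hY hx))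
    have h2 : (X * y₀) =O[l] fun k => S k ^ 2 := by
      simp only [sq]
      exact hXS.mul hyS
    refine (mulO h1 h2).congr' ?_ EventuallyEq.rfl
    filter_upwards [hD, hne] with k hk hk'
    have := hk'.1
    simp only [Pi.mul_apply, Pi.sub_apply]
    rw [hk, div_eq_mul_inv (X k * α k), div_eq_mul_inv (Y k * γ k)]
    field_simp
  -- Multiplying the trace inequality by y₀² removes the singular factor 1/y₀.
  have hyτ : (fun k => y₀ k * τ k) =O[l] S := by
    refine Asymptotics.IsBigO.of_pow (n := 2) two_ne_zero ?_
    have h1 : (fun k => 4 * y₀ k ^ 2 + 4 * |y₀ k ^ 2 * D k|) =O[l] fun k => S k ^ 2 :=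
      ((hyS.pow 2).const_mul_left 4).add (hyD.abs_left.const_mul_left 4)
    refine Asymptotics.IsBigO.trans (Asymptotics.IsBigO.of_bound 1 ?_) h1
    filter_upwards [hτD] with k hk
    have h2 : 0 ≤ 4 * y₀ k ^ 2 + 4 * |y₀ k ^ 2 * D k| := by positivity
    rw [Real.norm_of_nonneg h2, one_mul, Pi.pow_apply, Real.norm_of_nonneg (sq_nonneg _), mul_pow,
      abs_mul, abs_of_nonneg (sq_nonneg (y₀ k))]
    nlinarith [mul_le_mul_of_nonneg_left hk (sq_nonneg (y₀ k))]
  -- In y₀τ every term but ψYδ is O(S), and Yδ is bounded away from zero.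
  have h1 : ((fun k => (Y k * δ k)⁻¹) * ((fun k => y₀ k * τ k) -
      A * α * (fun k => (x₀ k)⁻¹) * X * y₀ - B * γ * Y * (fun k => (x₀ k)⁻¹) * y₀ - C * β * X))
      =O[l] S :=
    mulO hYδ (((hyτ.sub (mulO (mulO (mulO (mulO hA hα) hx) hX) hyS)).sub
      (mulO (mulO (mulO (mulO hB hγ) hY) hx) hyS)).sub (mulO (mulO hC hβ) hXS))
  refine h1.congr' ?_ EventuallyEq.rfl
  filter_upwards [hτ, hne] with k hk hk'
  obtain ⟨hk1, hk2⟩ := hk'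
  simp only [Pi.mul_apply, Pi.sub_apply]
  rw [hk, div_eq_mul_inv (X k * α k), div_eq_mul_inv (Y k * γ k), inv_mul_eq_iff_eq_mul₀ hk2]
  field_simp
  ring

/-- Follows from (1 + e)^k ≤ exp(k e). -/
theorem tendsto_one_add_pow_sub_one {l : Filter ℕ} {e : ℕ → ℝ} (he0 : ∀ k, 0 ≤ e k)
    (he : Tendsto (fun k : ℕ => (k : ℝ) * e k) l (𝓝 0)) :
    Tendsto (fun k => (1 + e k) ^ k - 1) l (𝓝 0) := by
  have h1 : Tendsto (fun k : ℕ => Real.exp (k * e k) - 1) l (𝓝 0) := by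
    simpa using ((Real.continuous_exp.tendsto 0).comp he).sub_const 1
  refine squeeze_zero (fun k => ?_) (fun k => ?_) h1
  · exact sub_nonneg.2 (one_le_pow₀ (by linarith [he0 k]))
  · rw [Real.exp_nat_mul]
    have := Real.add_one_le_exp (e k)
    have h2 := he0 k
    gcongr
    linarith

/-- Asymptotics of the passages near the saddle along a family of orbits whose initial points
and end points stay bounded. -/
theorem LocalControl.exists_passage_asymptotics {f : ℝ × ℝ → ℝ × ℝ} {lam sig : ℝ}
    {F G : ℝ × ℝ → ℝ} {N : Set (ℝ × ℝ)} {M η ρ : ℝ} (h : LocalControl f lam sig F G N M η ρ)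
    {K : Set ℕ} {p : ℕ → ℝ × ℝ} (hmem : ∀ k ∈ K, ∀ j < k, f^[j] (p k) ∈ thinNbhd N η)
    {x y : ℝ} (hp : Tendsto (fun k => (p k).1) (atTop ⊓ 𝓟 K) (𝓝 x))
    (hq : Tendsto (fun k => (f^[k] (p k)).2) (atTop ⊓ 𝓟 K) (𝓝 y)) :
    ∃ a b α β γ δ : ℕ → ℝ,
      Tendsto a (atTop ⊓ 𝓟 K) (𝓝 1) ∧ Tendsto b (atTop ⊓ 𝓟 K) (𝓝 1) ∧
      Tendsto α (atTop ⊓ 𝓟 K) (𝓝 1) ∧ Tendsto β (atTop ⊓ 𝓟 K) (𝓝 0) ∧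
      Tendsto γ (atTop ⊓ 𝓟 K) (𝓝 0) ∧ Tendsto δ (atTop ⊓ 𝓟 K) (𝓝 1) ∧
      ∀ k ∈ K, (f^[k] (p k)).1 = lam ^ k * (p k).1 * a k ∧
        (f^[k] (p k)).2 = sig ^ k * (p k).2 * b k ∧
        fderiv ℝ f^[k] (p k) ((p k).1, 0) = ((f^[k] (p k)).1 * α k, (f^[k] (p k)).2 * γ k) ∧
        fderiv ℝ f^[k] (p k) (0, (p k).2) = ((f^[k] (p k)).1 * β k, (f^[k] (p k)).2 * δ k) := by
  set e : ℕ → ℝ := fun k => 6 * M ^ 2 * (ρ ^ k * (|(p k).1| * |(f^[k] (p k)).2|)) with he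
  have hρ := h.rho_pos
  have he0 : ∀ k, 0 ≤ e k := fun k => by positivity
  have hA : Tendsto (fun k => (1 + e k) ^ k - 1) (atTop ⊓ 𝓟 K) (𝓝 0) := by
    refine tendsto_one_add_pow_sub_one he0 ?_
    have h1 : Tendsto (fun k : ℕ => (k : ℝ) * ρ ^ k) (atTop ⊓ 𝓟 K) (𝓝 0) :=
      (tendsto_self_mul_const_pow_of_lt_one hρ.le h.rho_lt_one).mono_left inf_le_left
    have h2 := (h1.mul (hp.abs.mul hq.abs)).const_mul (6 * M ^ 2)
    simp only [zero_mul, mul_zero] at h2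
    refine h2.congr fun k => ?_
    simp only [he]
    ring
  have hpass := fun k (hk : k ∈ K) => h.passage (hmem k hk) (le_refl (e k))
  choose! a b α β γ δ h1 h2 h3 h4 ha hb hα hβ hγ hδ using hpass
  have lim : ∀ {u : ℕ → ℝ} {c : ℝ}, (∀ k ∈ K, |u k - c| ≤ (1 + e k) ^ k - 1) →
      Tendsto u (atTop ⊓ 𝓟 K) (𝓝 c) := by
    intro u c hu
    rw [tendsto_iff_dist_tendsto_zero]
    refine squeeze_zero' (Eventually.of_forall fun k => dist_nonneg) ?_ hA
    filter_upwards [mem_inf_of_right (mem_principal_self K)] with k hk using hu k hk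
  exact ⟨a, b, α, β, γ, δ, lim ha, lim hb, lim hα, lim (by simpa using hβ), lim (by simpa using hγ),
    lim hδ, fun k hk => ⟨h1 k hk, h2 k hk, h3 k hk, h4 k hk⟩⟩

theorem contDiff_iterate {f : ℝ × ℝ → ℝ × ℝ} (hf : ContDiff ℝ ∞ f) (n : ℕ) :
    ContDiff ℝ ∞ f^[n] := by
  induction n with
  | zero => exact contDiff_id
  | succ n ih => exact ih.comp hf

/-- Sampling the orbit at multiples of the period makes p a stable fixed point of the return map. -/
theorem IsStableOrbit.trace_sq_le {f : ℝ × ℝ → ℝ × ℝ} {p : ℝ × ℝ} (h : IsStableOrbit f p)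
    (hf : Differentiable ℝ f) {m k : ℕ} (hper : f^[m] (f^[k] p) = p) :
    planarTrace ((fderiv ℝ f^[m] (f^[k] p)).comp (fderiv ℝ f^[k] p)) ^ 2 ≤
      4 + 4 * |planarDet ((fderiv ℝ f^[m] (f^[k] p)).comp (fderiv ℝ f^[k] p))| := by
  have hd : HasFDerivAt (f^[m] ∘ f^[k])
      ((fderiv ℝ f^[m] (f^[k] p)).comp (fderiv ℝ f^[k] p)) p :=
    (hf.iterate m _).hasFDerivAt.comp p (hf.iterate k _).hasFDerivAt
  refine trace_sq_le_of_stable hd hper fun ε hε => ?_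
  obtain ⟨δ, hδ, hδε⟩ := h ε hε
  refine ⟨δ, hδ, fun q hq n => ?_⟩
  have h1 := hδε q hq ((m + k) * n)
  rw [Function.iterate_mul, Function.iterate_add,
    Function.iterate_fixed (show (f^[m] ∘ f^[k]) p = p from hper)] at h1
  exact h1

/-- If the powers of `r` converge to a nonzero limit along an infinite set, then `|r| = 1`. -/
theorem abs_eq_one_of_tendsto_pow {l : Filter ℕ} [l.NeBot] (hl : l ≤ atTop) {r c : ℝ} (hc : c ≠ 0)
    (h : Tendsto (fun k => r ^ k) l (𝓝 c)) : |r| = 1 ∧ |c| = 1 ∧ (r = 1 → c = 1) := by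
  have h1 : Tendsto (fun k => |r| ^ k) l (𝓝 |c|) := by simpa [abs_pow] using h.abs
  have hr : |r| = 1 := by
    rcases lt_trichotomy |r| 1 with hr | hr | hr
    · have h2 := (tendsto_pow_atTop_nhds_zero_of_lt_one (abs_nonneg r) hr).mono_left hl
      exact absurd (abs_eq_zero.1 (tendsto_nhds_unique h1 h2)) hc
    · exact hr
    · exact absurd h1 (not_tendsto_nhds_of_tendsto_atTop
        ((tendsto_pow_atTop_atTop_of_one_lt hr).mono_left hl) _)
  refine ⟨hr, ?_, ?_⟩
  · simp only [hr, one_pow] at h1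
    exact (tendsto_nhds_unique h1 tendsto_const_nhds)
  · rintro rfl
    simp only [one_pow] at h
    exact (tendsto_nhds_unique h tendsto_const_nhds)

/-! ### The quadratic tangency -/

/-- At a nondegenerate quadratic tangency, a bound on the vertical derivative turns the closing
equation into an asymptotic relation between the distances from the two axes. -/
theorem tendsto_div_of_tangency {l : Filter ℕ} {h ψ : ℝ × ℝ → ℝ} {h' ψ' : ℝ × ℝ →L[ℝ] ℝ}
    {y d : ℝ} (hh : HasFDerivAt h h' (0, y)) (hψ : HasFDerivAt ψ ψ' (0, y)) (h0 : h (0, y) = 0)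
    (hh1 : h' (1, 0) = d) (hh2 : h' (0, 1) = 0) (hψ0 : ψ (0, y) = 0) (hψ2 : ψ' (0, 1) ≠ 0)
    {q : ℕ → ℝ × ℝ} (hq : Tendsto q l (𝓝 (0, y))) (hq0 : ∀ᶠ k in l, (q k).1 ≠ 0)
    (hψO : (fun k => ψ (q k)) =O[l] fun k => |(q k).1| + |h (q k)|) :
    Tendsto (fun k => h (q k) / (q k).1) l (𝓝 d) := by
  set S : ℕ → ℝ := fun k => |(q k).1| + |h (q k)| with hS
  have hS0 : ∀ k, 0 ≤ S k := fun k => by positivity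
  have hXS : (fun k => (q k).1) =O[l] S := Asymptotics.IsBigO.of_bound 1
    (Eventually.of_forall fun k => by
      rw [Real.norm_eq_abs, Real.norm_of_nonneg (hS0 k), one_mul]
      exact le_add_of_nonneg_right (abs_nonneg _))
  have hqb : (fun k => q k - (0, y)) =O[l] fun k => |ψ (q k)| + |(q k).1| := by
    have h1 := (hψ.isLittleO.comp_tendsto hq).def
      (show 0 < |ψ' (0, 1)| / 2 from half_pos (abs_pos.2 hψ2))
    have hψ3 : 0 < |ψ' (0, 1)| := abs_pos.2 hψ2
    set c := |ψ' (0, 1)|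
    -- Linearizing ψ with error (c/2)‖q - (0, y)‖ leaves half of c|Y - y| on the left after
    -- absorption; dividing by c/2 gives the constant.
    have hcb : ∀ᶠ k in l, |(q k).2 - y| ≤
        (2 + 2 * |ψ' (1, 0)| + c) / c * (|ψ (q k)| + |(q k).1|) := by
      filter_upwards [h1] with k hk
      have h2 : ψ' (q k - (0, y)) = (q k).1 * ψ' (1, 0) + ((q k).2 - y) * ψ' (0, 1) := by
        rw [← smul_eq_mul, ← smul_eq_mul, ← map_smul, ← map_smul, ← map_add]
        congr 1
        ext <;> simp
      simp only [Function.comp_apply, hψ0, sub_zero] at hk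
      rw [h2] at hk
      have h3 : ‖q k - (0, y)‖ ≤ |(q k).1| + |(q k).2 - y| := by
        refine norm_prod_le_iff.2 ⟨?_, ?_⟩
        · simp
        · simp
      have h4 : |((q k).2 - y) * ψ' (0, 1)| ≤
          |ψ (q k) - ((q k).1 * ψ' (1, 0) + ((q k).2 - y) * ψ' (0, 1))| + |ψ (q k)| +
            |(q k).1 * ψ' (1, 0)| := by
        have e1 : ((q k).2 - y) * ψ' (0, 1) =
          -(ψ (q k) - ((q k).1 * ψ' (1, 0) + ((q k).2 - y) * ψ' (0, 1))) + ψ (q k) +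
            -((q k).1 * ψ' (1, 0)) := by ring
        conv_lhs => rw [e1]
        refine (abs_add_three _ _ _).trans ?_
        rw [abs_neg, abs_neg]
      rw [Real.norm_eq_abs] at hk
      rw [abs_mul, abs_mul] at h4
      rw [div_mul_eq_mul_div, le_div_iff₀ hψ3]
      have h5 := mul_le_mul_of_nonneg_left h3 hψ3.le
      change |(q k).2 - y| * c ≤ _ at h4
      nlinarith [abs_nonneg (ψ (q k)), abs_nonneg (q k).1, abs_nonneg (ψ' (1, 0)),
        mul_nonneg (abs_nonneg (ψ (q k))) (abs_nonneg (ψ' (1, 0))),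
        mul_nonneg (abs_nonneg (ψ (q k))) hψ3.le]
    refine Asymptotics.IsBigO.of_bound (max 1 ((2 + 2 * |ψ' (1, 0)| + c) / c)) ?_
    filter_upwards [hcb] with k hk
    have h0 : 0 ≤ |ψ (q k)| + |(q k).1| := by positivity
    rw [Real.norm_of_nonneg h0]
    refine norm_prod_le_iff.2 ⟨?_, ?_⟩
    · refine le_trans ?_ (mul_le_mul_of_nonneg_right (le_max_left _ _) h0)
      simp
    · exact hk.trans (mul_le_mul_of_nonneg_right (le_max_right _ _) h0)
  have hqS : (fun k => q k - (0, y)) =O[l] S := hqb.trans (hψO.abs_left.add hXS.abs_left)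
  have hlin : (fun k => h (q k) - (q k).1 * d) =o[l] S := by
    refine ((hh.isLittleO.comp_tendsto hq).trans_isBigO hqS).congr_left fun k => ?_
    have h2 : h' (q k - (0, y)) = (q k).1 * h' (1, 0) + ((q k).2 - y) * h' (0, 1) := by
      rw [← smul_eq_mul, ← smul_eq_mul, ← map_smul, ← map_smul, ← map_add]
      congr 1
      ext <;> simp
    simp only [Function.comp_apply, h0, sub_zero, h2, hh1, hh2, mul_zero, add_zero]
  -- From |h| ≤ S/2 + |d||X| and S = |X| + |h|, the half of S is absorbed.
  have hSX : S =O[l] fun k => (q k).1 := by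
    refine Asymptotics.IsBigO.of_bound (2 * (1 + |d|)) ?_
    filter_upwards [hlin.def (show (0 : ℝ) < 1 / 2 by norm_num)] with k hk
    rw [Real.norm_of_nonneg (hS0 k)] at hk ⊢
    rw [Real.norm_eq_abs] at hk ⊢
    have h1 : |h (q k)| ≤ |h (q k) - (q k).1 * d| + |(q k).1| * |d| := by
      rw [← abs_mul]
      simpa using abs_add_le (h (q k) - (q k).1 * d) ((q k).1 * d)
    have h2 : S k = |(q k).1| + |h (q k)| := rfl
    nlinarith
  have h1 := (hlin.trans_isBigO hSX).tendsto_div_nhds_zero.add_const d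
  rw [zero_add] at h1
  refine h1.congr' ?_
  filter_upwards [hq0] with k hk
  field_simp
  ring

end HomoclinicTangency

/-! ### The main theorem -/

theorem mainTheorem1
    (f : ℝ × ℝ → ℝ × ℝ) (hf : ContDiff ℝ ∞ f)
    (lam sig : ℝ) (hlam0 : 0 < |lam|) (hlam1 : |lam| < 1) (hsig : 1 < |sig|)
    (F G : ℝ × ℝ → ℝ) (hF : ContDiff ℝ ∞ F) (hG : ContDiff ℝ ∞ G)
    (N : Set (ℝ × ℝ)) (hN_nhds : N ∈ 𝓝 ((0, 0) : ℝ × ℝ))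
    (hN_bdd : Bornology.IsBounded N) (hN_conv : Convex ℝ N)
    (hfN : ∀ p ∈ N, f p = HomoclinicTangency.localMap lam sig F G p)
    (xstar ystar : ℝ) (hxstar : 0 < xstar) (hystar : 0 < ystar)
    (hx0 : (xstar, (0 : ℝ)) ∈ N) (hx1 : (lam * xstar, (0 : ℝ)) ∈ N)
    (hy1 : ((0 : ℝ), ystar / sig) ∈ N) (hy2 : ((0 : ℝ), ystar / sig ^ 2) ∈ N)
    (m : ℕ) (hm : 1 ≤ m) (hhom : f^[m] (0, ystar) = (xstar, 0))
    (hdet : HomoclinicTangency.c₁ f^[m] ystar * HomoclinicTangency.d₂ f^[m] ystar -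
      HomoclinicTangency.c₂ f^[m] ystar * HomoclinicTangency.d₁ f^[m] ystar ≠ 0) :
    ∃ η > 0, ∀ (K : Set ℕ) (p : ℕ → ℝ × ℝ) (V : Set (ℝ × ℝ)),
      K.Infinite →
      (∀ k ∈ K, HomoclinicTangency.IsSRSolution f N η m k (p k)) →
      (∀ k ∈ K, HomoclinicTangency.IsStableOrbit f (p k)) →
      Tendsto p (atTop ⊓ 𝓟 K) (𝓝 (xstar, 0)) →
      V ∈ 𝓝 ((0 : ℝ), ystar) → Set.InjOn f^[m] V → (∀ k ∈ K, f^[k] (p k) ∈ V) →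
      HomoclinicTangency.d₂ f^[m] ystar = 0 ∧
      (HomoclinicTangency.d₅ f^[m] ystar ≠ 0 →
        |lam * sig| = 1 ∧
        |HomoclinicTangency.d₁ f^[m] ystar| = ystar / xstar ∧
        (lam * sig = 1 → HomoclinicTangency.d₁ f^[m] ystar = ystar / xstar)) := by
  open HomoclinicTangency in
  obtain ⟨M, η, ρ, h⟩ := exists_localControl hf hlam0 hlam1 hsig hF hG hN_nhds hN_bdd hN_conv hfN
  refine ⟨η, h.eta_pos, fun K p V hK hSR hst hp hV hinj hqV => ?_⟩
  set T := f^[m] with hT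
  set l : Filter ℕ := atTop ⊓ 𝓟 K with hl
  have hlK : ∀ᶠ k in l, k ∈ K := mem_inf_of_right (mem_principal_self K)
  have : l.NeBot := Filter.frequently_mem_iff_neBot.1 (Nat.frequently_atTop_iff_infinite.2 hK)
  have hTc : ContDiff ℝ ∞ T := contDiff_iterate hf m
  have hTd : Differentiable ℝ T := hTc.differentiable (by simp)
  have hTdc : Continuous (fderiv ℝ T) := hTc.continuous_fderiv (by simp)
  have hψc : ContDiff ℝ ∞ fun q => (fderiv ℝ T q (0, 1)).2 :=
    contDiff_snd.comp ((hTc.fderiv_right (m := ∞) (by simp)).clm_apply contDiff_const)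
  have hψd := hψc.differentiable (by simp)
  rw [c₁_eq hTd, c₂_eq hTd, d₁_eq hTd, d₂_eq hTd] at hdet
  have hq : Tendsto (fun k => f^[k] (p k)) l (𝓝 (0, ystar)) := by
    refine tendsto_of_injOn hTc hdet hV hinj (hlK.mono hqV) ?_
    rw [hhom]
    refine hp.congr' ?_
    filter_upwards [hlK] with k hk using (hSR k hk).map_iterate.symm
  have hp1 := (continuous_fst.tendsto _).comp hp
  have hp2 := (continuous_snd.tendsto _).comp hp
  have hq1 := (continuous_fst.tendsto _).comp hq
  have hq2 := (continuous_snd.tendsto _).comp hq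
  obtain ⟨a, b, α, β, γ, δ, ha, hb, hα, hβ, hγ, hδ, hrel⟩ :=
    h.exists_passage_asymptotics (fun k hk => (hSR k hk).mem_thinNbhd) hp1 hq2
  have hne : ∀ᶠ k in l, (p k).1 ≠ 0 ∧ (p k).2 ≠ 0 ∧ (f^[k] (p k)).1 ≠ 0 ∧ (f^[k] (p k)).2 ≠ 0 ∧
      a k ≠ 0 ∧ b k ≠ 0 ∧ δ k ≠ 0 := by
    filter_upwards [hlK, hp1.eventually_ne hxstar.ne', hq2.eventually_ne hystar.ne',
      ha.eventually_ne one_ne_zero, hb.eventually_ne one_ne_zero, hδ.eventually_ne one_ne_zero]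
      with k hk h1 h2 h3 h4 h5
    simp only [Function.comp_apply] at h1 h2
    obtain ⟨e1, e2, -, -⟩ := hrel k hk
    refine ⟨h1, ?_, ?_, h2, h3, h4, h5⟩
    · rintro h0
      rw [h0] at e2
      exact h2 (by simpa using e2)
    · rw [e1]
      exact mul_ne_zero (mul_ne_zero (pow_ne_zero _ h.lam_ne_zero) h1) h3
  have happ : ∀ v : ℝ × ℝ, Tendsto (fun k => fderiv ℝ T (f^[k] (p k)) v) l
      (𝓝 (fderiv ℝ T (0, ystar) v)) := fun v =>
    ((hTdc.clm_apply continuous_const).tendsto _).comp hq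
  have hO : ∀ {u : ℕ → ℝ} {c : ℝ}, Tendsto u l (𝓝 c) → u =O[l] (1 : ℕ → ℝ) :=
    fun hu => hu.isBigO_one ℝ
  -- The scaled columns are divided by x₀ and y₀ to recover the matrix entries.
  have hentry : ∀ᶠ k in l,
      fderiv ℝ f^[k] (p k) (1, 0) =
        ((f^[k] (p k)).1 * α k / (p k).1, (f^[k] (p k)).2 * γ k / (p k).1) ∧
      fderiv ℝ f^[k] (p k) (0, 1) =
        ((f^[k] (p k)).1 * β k / (p k).2, (f^[k] (p k)).2 * δ k / (p k).2) := by
    filter_upwards [hlK, hne] with k hk hk'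
    obtain ⟨h1, h2, -⟩ := hk'
    obtain ⟨-, -, e3, e4⟩ := hrel k hk
    constructor
    · have : ((1, 0) : ℝ × ℝ) = (p k).1⁻¹ • ((p k).1, 0) := by ext <;> simp [h1]
      rw [this, map_smul, e3]
      ext <;> simp <;> ring
    · have : ((0, 1) : ℝ × ℝ) = (p k).2⁻¹ • (0, (p k).2) := by ext <;> simp [h2]
      rw [this, map_smul, e4]
      ext <;> simp <;> ring
  have hψO : (fun k => (fderiv ℝ T (f^[k] (p k)) (0, 1)).2) =O[l]
      fun k => |(f^[k] (p k)).1| + |(p k).2| := by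
    refine vertical_derivative_isBigO
      (A := fun k => (fderiv ℝ T (f^[k] (p k)) (1, 0)).1)
      (B := fun k => (fderiv ℝ T (f^[k] (p k)) (0, 1)).1)
      (C := fun k => (fderiv ℝ T (f^[k] (p k)) (1, 0)).2)
      (hO (happ _).fst_nhds) (hO (happ _).fst_nhds) (hO (happ _).snd_nhds) (hO (happ _).snd_nhds)
      (hO hα) (hO hβ) (hO hγ) (hO hδ) (hO hq2) (hO hq1) (hO (hp1.inv₀ hxstar.ne'))
      (hO ((hq2.mul hδ).inv₀ (by simpa using hystar.ne')))
      (τ := fun k => planarTrace ((fderiv ℝ T (f^[k] (p k))).comp (fderiv ℝ f^[k] (p k))))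
      (D := fun k => planarDet ((fderiv ℝ T (f^[k] (p k))).comp (fderiv ℝ f^[k] (p k))))
      ?_ ?_ ?_ ?_
    · filter_upwards [hne] with k hk
      exact ⟨hk.2.1, mul_ne_zero hk.2.2.2.1 hk.2.2.2.2.2.2⟩
    · filter_upwards [hentry] with k hk
      simp only [planarTrace, ContinuousLinearMap.comp_apply, hk.1, hk.2]
      rw [planar_apply _ ((f^[k] (p k)).1 * α k / (p k).1, _),
        planar_apply _ ((f^[k] (p k)).1 * β k / (p k).2, _)]
      simp
      ring
    · filter_upwards [hentry] with k hk
      rw [planarDet_comp, planarDet, planarDet, hk.1, hk.2]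
      rfl
    · filter_upwards [hlK] with k hk
      exact (hst k hk).trace_sq_le (hf.differentiable (by simp)) (hSR k hk).map_iterate
  have hd₂ : d₂ T ystar = 0 := by
    rw [d₂_eq hTd]
    have h1 : Tendsto (fun k => |(f^[k] (p k)).1| + |(p k).2|) l (𝓝 0) := by
      simpa using hq1.abs.add hp2.abs
    exact tendsto_nhds_unique (happ _).snd_nhds (hψO.trans_tendsto h1)
  refine ⟨hd₂, fun hd₅ => ?_⟩
  have hd₂' := hd₂
  rw [d₂_eq hTd] at hd₂'
  -- With d₂ = 0 the determinant is -c₂d₁.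
  have hd₁ : d₁ T ystar ≠ 0 := by
    intro h0
    rw [d₁_eq hTd] at h0
    rw [h0, hd₂'] at hdet
    simp at hdet
  have hclose : ∀ᶠ k in l, (T (f^[k] (p k))).2 = (p k).2 := by
    filter_upwards [hlK] with k hk
    rw [hT, (hSR k hk).map_iterate]
  have hratio : Tendsto (fun k => (p k).2 / (f^[k] (p k)).1) l (𝓝 (d₁ T ystar)) := by
    have h1 := tendsto_div_of_tangency (l := l) (h := fun q => (T q).2)
      (hTd (0, ystar)).hasFDerivAt.snd (hψd (0, ystar)).hasFDerivAt (by simp [hhom])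
      (d₁_eq hTd ystar).symm hd₂' hd₂' (by
        rw [← d₅_eq hTd hψd]
        exact mul_ne_zero two_ne_zero hd₅) hq (hne.mono fun k hk => hk.2.2.1) (by
        refine hψO.congr' EventuallyEq.rfl ?_
        filter_upwards [hclose] with k hk
        rw [hk])
    refine h1.congr' ?_
    filter_upwards [hclose] with k hk
    rw [hk]
  -- The product of the two passage relations gives (λσ)^k = (Y / (a b x₀)) / (y₀ / X).
  have hpow : Tendsto (fun k => (lam * sig) ^ k) l (𝓝 (ystar / xstar / d₁ T ystar)) := by
    have h1 := ((hq2.div ((ha.mul hb).mul hp1) (by simpa using hxstar.ne')).div hratio hd₁)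
    rw [one_mul, one_mul] at h1
    refine h1.congr' ?_
    filter_upwards [hlK, hne] with k hk hk'
    obtain ⟨e1, e2, -, -⟩ := hrel k hk
    obtain ⟨n1, n2, n3, n4, n5, n6, -⟩ := hk'
    simp only [Function.comp_apply, Pi.div_apply]
    rw [div_div_eq_mul_div, e2, e1, mul_pow]
    field_simp
  obtain ⟨r1, r2, r3⟩ := abs_eq_one_of_tendsto_pow inf_le_left
    (div_ne_zero (div_ne_zero hystar.ne' hxstar.ne') hd₁) hpow
  refine ⟨r1, ?_, fun hr => ?_⟩
  · rw [abs_div, div_eq_one_iff_eq (abs_ne_zero.2 hd₁), abs_of_pos (by positivity)] at r2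
    exact r2.symm
  · exact ((div_eq_one_iff_eq hd₁).1 (r3 hr)).symm
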